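/- **Model.** There are finitely many bandits, $K\ge 1$. Bandit $k$ has a finite nonempty state set $N_k$; the $N_k$ are disjoint, $N=\bigcup_k N_k$, and $b(i)$ is the bandit of state $i$. Bandit $k$ has a transition rate matrix $q^k=(q(i,j))_{i,j\in N_k}$ and a reward vector $r^k=(r(i))_{i\in N_k}$ with real entries. A multi-state $s$ picks one state $s_k\in N_k$ for each $k$; $S$ is the set of multi-states. A policy is a map $\pi:S\to\{1,\dots,K\}$. It has the $S\times S$ matrix $Q^\pi$ and the vector $R^\pi$ given by $Q^\pi(s,t)=q(s_{\pi(s)},t_{\pi(s)})$ if $t_k=s_k$ for all $k\ne\pi(s)$, $Q^\pi(s,t)=0$ otherwise, and $R^\pi(s)=r(s_{\pi(s)})$. Put $V^\pi=(I-Q^\pi)^{-1}R^\pi$ and $F(s)=\max_\pi V^\pi(s)$, the maximum being over all policies. **Hypothesis C.** Each $q^k$ is nonnegative and transient (each entry of $(q^k)^t$ tends to $0$ as $t\to\infty$), and at least one of the following holds: (RN) each row of each $q^k$ sums to at most $1$; (RA) $r(i)\le 0$ for all $i\in N$; (RS) $r(i)\ge 0$ for all $i\in N$. Fix one of the cases RN,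 RA, RS that holds. **Labelings.** A labeling is an injective map $L:N\to\{1,\dots,|N|\}$. The priority rule keyed to $L$ plays, in each multi-state $s$, the bandit $k$ for which $L(s_k)$ is smallest. The labeling $L$ is optimal if this rule $\pi$ has $V^\pi(s)=F(s)$ for every $s\in S$. **Weak preference.** For given data $q,r$, put $a(i)=\sum_{j\in N_{b(i)}}q(i,j)$. The category of a state $j$ is * in case RN: $1$ if $a(j)=1$ and $r(j)\ge0$; $2$ if $a(j)<1$; $3$ if $a(j)=1$ and $r(j)<0$; * in case RA: $1$ if $r(j)=0$ and $a(j)\le1$; $2$ if $r(j)<0$; $3$ if $r(j)=0$ and $a(j)>1$; * in case RS: $1$ if $r(j)=0$ and $a(j)\ge1$; $2$ if $r(j)>0$; $3$ if $r(j)=0$ and $a(j)<1$. State $i$ is weakly preferable to state $j$ if $r(i)+a(i)r(j)>r(j)+a(j)r(i)$, or if equality holds here and the category of $i$ is at most that of $j$. **Pivot step** for a state $i$ in a subset $M$ of $N_k$: in the tableau $[I-q^k,\,r^k]$, multiply row $i$ by $1/(1-q(i,i))$; then, for each $j\in M\setminus\{i\}$, add $q(j,i)$ times the new row $i$ to row $j$.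 **Optimizer.** 1. Set $n=1$ and $M_k=N_k$ for each $k$. Let $C$ consist of one state from each $N_k$ that is weakly preferable to all states in $N_k$ for the original data. 2. While all $M_k$ are nonempty, do Step 3. 3. Find a state $i\in C$ that is weakly preferable to all states in $C$ for the current data. Let $k=b(i)$, set $L(i)=n$, and increase $n$ by $1$. Execute the pivot step for $i$ in $M_k$ to update the data of bandit $k$. Remove $i$ from $C$ and from $M_k$. If $M_k$ is still nonempty, put into $C$ a state of $M_k$ that is weakly preferable to all states of $M_k$ for the updated data. When it stops, the unlabeled states receive the labels $n,\dots,|N|$ in any one-to-one way. Any choice that these rules allow may be made. **Proposition.** Suppose Hypothesis C is satisfied. Then the Optimizer can always be carried out: the states that it seeks exist at every step, and it stops after finitely many steps. Each state that it labels is, for the data current at that moment, weakly preferable to all states not yet labeled. Whatever choices are made, it constructs a labeling $L$, and $L$ is optimal: the priority rule $\pi$ keyed to $L$ has $V^{\pi}(s)=F(s)$ for every multi-state $s$. -/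

import Mathlib

open Filter Topology

noncomputable section

namespace Bandit

/-- A square matrix is transient if every entry of its powers tends to zero. -/
def IsTransient {S : Type*} [Fintype S] [DecidableEq S] (Q : Matrix S S ℝ) : Prop :=
  ∀ s t, Tendsto (fun n : ℕ => (Q ^ n) s t) atTop (𝓝 0)

/-- The data of a family of bandits indexed by `ι`, bandit `k` having the state set `N k`:
transition rates `q k i j` and rewards `r k i`.  The set of all states of all bandits is
the disjoint union `Σ k, N k`, and a multi-state is an element of `∀ k, N k`. -/
structure Data {ι : Type*} (N : ι → Type*) where
  /-- The transition rate matrix of each bandit. -/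
  q : ∀ k, Matrix (N k) (N k) ℝ
  /-- The reward vector of each bandit. -/
  r : ∀ k, N k → ℝ

/-- The three cases: risk neutral, risk averse, risk seeking. -/
inductive Attitude
  | neutral
  | averse
  | seeking

section Model

variable {ι : Type*} [Fintype ι] [DecidableEq ι] {N : ι → Type*}
  [∀ k, Fintype (N k)] [∀ k, DecidableEq (N k)]

/-- The three versions of the standing hypothesis.  In every version the transition rate
matrices are nonnegative and transient; in addition they are substochastic (neutral),
the rewards are nonpositive (averse), or the rewards are nonnegative (seeking). -/
def Hypothesis (c : Attitude) (D : Data N) : Prop :=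
  (∀ k, (∀ i j, 0 ≤ D.q k i j) ∧ IsTransient (D.q k)) ∧
  match c with
  | .neutral => ∀ k i, ∑ j, D.q k i j ≤ 1
  | .averse => ∀ k i, D.r k i ≤ 0
  | .seeking => ∀ k i, 0 ≤ D.r k i

/-- The transition rate matrix of a stationary nonrandomized policy `π`: the rate from the
multi-state `s` to `t` is `q (s k) (t k)`, where `k = π s` is the bandit that is played, if
`t` agrees with `s` in all other bandits, and is zero otherwise. -/
def policyMatrix (D : Data N) (π : (∀ k, N k) → ι) : Matrix (∀ k, N k) (∀ k, N k) ℝ :=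
  fun s t => if ∀ k, k ≠ π s → t k = s k then D.q (π s) (s (π s)) (t (π s)) else 0

/-- The reward vector of a policy. -/
def policyReward (D : Data N) (π : (∀ k, N k) → ι) : (∀ k, N k) → ℝ :=
  fun s => D.r (π s) (s (π s))

/-- The expected utility vector `(I - Q)⁻¹ R` of a policy. -/
def policyValue (D : Data N) (π : (∀ k, N k) → ι) : (∀ k, N k) → ℝ :=
  Matrix.mulVec (1 - policyMatrix D π)⁻¹ (policyReward D π)

/-- The largest expected utility over all (finitely many) stationary nonrandomized policies,
for each starting multi-state. -/
def optimalValue (D : Data N) (s : ∀ k, N k) : ℝ :=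
  ⨆ π : (∀ k, N k) → ι, policyValue D π s

/-- A labeling gives distinct labels between `1` and the number of states to all states.
(The label of the termination state is fixed, exceeds all others and is left out.) -/
def IsLabeling (L : (Σ k, N k) → ℕ) : Prop :=
  Function.Injective L ∧ ∀ x, 1 ≤ L x ∧ L x ≤ Fintype.card (Σ k, N k)

/-- The priority rule keyed to `L`: play the bandit whose current state has the lowest label. -/
def priorityRule [Nonempty ι] (L : (Σ k, N k) → ℕ) : (∀ k, N k) → ι :=
  fun s => Function.argmin (fun k => L ⟨k, s k⟩)

/-- A labeling is optimal if its priority rule attains the largest expected utility from every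
multi-state. -/
def IsOptimalLabeling [Nonempty ι] (D : Data N) (L : (Σ k, N k) → ℕ) : Prop :=
  IsLabeling L ∧ ∀ s, policyValue D (priorityRule L) s = optimalValue D s

/-- The amplification of a state. -/
def amplification (D : Data N) (x : Σ k, N k) : ℝ := ∑ j, D.q x.1 x.2 j

/-- The category of a state; the rule depends on the case at hand. -/
def category (c : Attitude) (D : Data N) (x : Σ k, N k) : ℕ :=
  match c with
  | .neutral =>
      if amplification D x = 1 ∧ 0 ≤ D.r x.1 x.2 then 1
      else if amplification D x < 1 then 2 else 3
  | .averse =>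
      if D.r x.1 x.2 = 0 ∧ amplification D x ≤ 1 then 1
      else if D.r x.1 x.2 < 0 then 2 else 3
  | .seeking =>
      if D.r x.1 x.2 = 0 ∧ 1 ≤ amplification D x then 1
      else if 0 < D.r x.1 x.2 then 2 else 3

/-- State `x` is weakly preferable to state `y`: playing `x` first and `y` second is at least
as good as the other way around, and in case of a tie the category of `x` is at least as
small as that of `y`. -/
def WeaklyPreferable (c : Attitude) (D : Data N) (x y : Σ k, N k) : Prop :=
  D.r y.1 y.2 + amplification D y * D.r x.1 x.2
      < D.r x.1 x.2 + amplification D x * D.r y.1 y.2 ∨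
    (D.r x.1 x.2 + amplification D x * D.r y.1 y.2
      = D.r y.1 y.2 + amplification D y * D.r x.1 x.2 ∧
    category c D x ≤ category c D y)

/-- Row `i` of the tableau `[I - q, r]` of bandit `k`, times `1 / (1 - q i i)`: the part in the
columns of `I - q`. -/
def pivotRow (D : Data N) (k : ι) (i : N k) : N k → ℝ :=
  fun p => (1 / (1 - D.q k i i)) * (1 - D.q k : Matrix (N k) (N k) ℝ) i p

/-- The entry of the same row in the column of `r`. -/
def pivotReward (D : Data N) (k : ι) (i : N k) : ℝ :=
  (1 / (1 - D.q k i i)) * D.r k i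

/-- The tableau matrix `I - q` of bandit `k` after the pivot step for the state `i`, where `M` is
the current set of remaining states: row `i` is replaced by the pivot row, `q j i` times the
pivot row is added to every row `j ∈ M` with `j ≠ i`, and the other rows are kept. -/
def pivotMatrix (D : Data N) (k : ι) (M : Finset (N k)) (i : N k) : Matrix (N k) (N k) ℝ :=
  fun j p =>
    if j = i then pivotRow D k i p
    else if j ∈ M then
      (1 - D.q k : Matrix (N k) (N k) ℝ) j p + D.q k j i * pivotRow D k i p
    else (1 - D.q k : Matrix (N k) (N k) ℝ) j p

/-- The last column of the tableau after the pivot step. -/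
def pivotVector (D : Data N) (k : ι) (M : Finset (N k)) (i : N k) : N k → ℝ :=
  fun j =>
    if j = i then pivotReward D k i
    else if j ∈ M then D.r k j + D.q k j i * pivotReward D k i
    else D.r k j

/-- The data after the pivot step of the Triangularizer for state `i` of bandit `k`:
the tableau of bandit `k` is updated, the other bandits are left alone. -/
def pivot (D : Data N) (k : ι) (M : Finset (N k)) (i : N k) : Data N where
  q := Function.update D.q k (1 - pivotMatrix D k M i)
  r := Function.update D.r k (pivotVector D k M i)

end Model

/-- The memory of the Optimizer: the current data, the set `C` of candidates, the next label
`n`, the set `M k` of the unlabeled states of each bandit, and the labels given so far. -/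
structure Memory {ι : Type*} (N : ι → Type*) where
  /-- The current data. -/
  data : Data N
  /-- The candidates. -/
  C : Set (Σ k, N k)
  /-- The next label. -/
  n : ℕ
  /-- The states that have not been removed. -/
  M : ∀ k, Finset (N k)
  /-- The labels given so far (`none` for an unlabeled state). -/
  label : (Σ k, N k) → Option ℕ

section Optimizer

variable {ι : Type*} [Fintype ι] [DecidableEq ι] {N : ι → Type*}
  [∀ k, Fintype (N k)] [∀ k, DecidableEq (N k)]

/-- Initialization of the Optimizer, for the original data `D`: the set `C` consists of one state of each
bandit that is weakly preferable to all states of that bandit; `n = 1`; `M k` is the set of all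
states of bandit `k`; nothing is labeled. -/
def IsInitial (c : Attitude) (D : Data N) (m : Memory N) : Prop :=
  m.data = D ∧
  (∃ e : ∀ k, N k,
    (∀ k j, WeaklyPreferable c D ⟨k, e k⟩ ⟨k, j⟩) ∧ m.C = Set.range fun k => ⟨k, e k⟩) ∧
  m.n = 1 ∧ (∀ k, m.M k = Finset.univ) ∧ ∀ x, m.label x = none

/-- The Optimizer stops as soon as all states of some bandit have been removed. -/
def Stopped (m : Memory N) : Prop := ∃ k, m.M k = ∅

/-- One iteration of the Optimizer (allowed only before it stops) that labels the
state `x` and turns the memory `m` into `m'`: the state `x ∈ C` is weakly preferable to all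
states in `C` with respect to the current data; it receives the label `n`, and `n` is
increased by one; the data of its bandit are updated by the pivot step for `x`; `x` is removed
from its bandit and from `C`; and, unless that bandit is exhausted, a remaining state `j` of
the bandit that is weakly preferable to all its remaining states with respect to the updated
data is put into `C`. -/
def Step (c : Attitude) (x : Σ k, N k) (m m' : Memory N) : Prop :=
  ¬ Stopped m ∧
  x ∈ m.C ∧ (∀ y ∈ m.C, WeaklyPreferable c m.data x y) ∧
  m'.label = Function.update m.label x (some m.n) ∧
  m'.n = m.n + 1 ∧
  m'.data = pivot m.data x.1 (m.M x.1) x.2 ∧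
  m'.M = Function.update m.M x.1 ((m.M x.1).erase x.2) ∧
  ((m'.M x.1 = ∅ ∧ m'.C = m.C \ {x}) ∨
    ∃ j ∈ m'.M x.1,
      (∀ j' ∈ m'.M x.1, WeaklyPreferable c m'.data ⟨x.1, j⟩ ⟨x.1, j'⟩) ∧
      m'.C = insert ⟨x.1, j⟩ (m.C \ {x}))

/-- The memory contents that can occur while the Optimizer is executed on the data `D`, with
all possible resolutions of its choices. -/
def Reachable (c : Attitude) (D : Data N) (m : Memory N) : Prop :=
  ∃ m₀, IsInitial c D m₀ ∧ Relation.ReflTransGen (fun u v => ∃ x, Step c x u v) m₀ m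

/-- `L` keeps the labels recorded in `m` and gives distinct labels from `m.n` up to the number
of states, in any way, to the states that are unlabeled in `m`. -/
def Completes (m : Memory N) (L : (Σ k, N k) → ℕ) : Prop :=
  (∀ x l, m.label x = some l → L x = l) ∧
  (∀ x, m.label x = none → m.n ≤ L x ∧ L x ≤ Fintype.card (Σ k, N k)) ∧
  Set.InjOn L {x | m.label x = none}

end Optimizer

end Bandit

end

/-!
The proof compares all policies with the solution `F` of the optimality equation
`F s = max_k (play D k F s)`, where `play D k F s` is the expected utility of playing bandit `k`
once in `s` and receiving `F` afterwards.

Transience of the bandits provides positive weights that the transition rates strictly decrease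
(`IsTransient.exists_weight`).  The products of these weights are strictly decreased by the matrix
of every policy, so a maximum principle holds for every policy (`Admissible.nonpos_of_le`).  It
shows that `F` exists, and that a policy is optimal if it attains the maximum in the optimality
equation everywhere.

Let the state `i` of bandit `k` be weakly preferable to all remaining states.  Playing `k` and `l` in
one order or the other makes a difference only through the two rewards, and weak preference
says that `k` should go first.  Hence the loss `F - play D k F` on the multi-states that contain
`i` is dominated by its average over the move of an optimally played bandit `l ≠ k`, and by
the maximum principle it vanishes (`Admissible.eq_play_of_weaklyPreferable`).  Thus playing `k` in
state `i` is fair under `F`, and so the pivot step for `i`, which eliminates `i` from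
bandit `k`, does not change `play D l F s` for the remaining multi-states `s`
(`Admissible.play_pivot`).  It keeps the weights as well (`Admissible.pivot`), and the argument can
be repeated with the same function `F`.  When the Optimizer stops, every multi-state contains
a labeled state, and the priority rule plays the one that was labeled first, in a
multi-state that had no labeled state at that time.

The Optimizer finds the states it needs because weak preference is a total preorder, the
lexicographic order of a category and a real index (`weaklyPreferable_iff`).
-/

set_option linter.unusedSectionVars false

noncomputable section

namespace Bandit

/-! ### Excessive weights and the maximum principle -/

/-- A transient nonnegative matrix has a positive vector that it strictly decreases, namely
a long enough partial sum of the series `∑ Q ^ t *ᵥ 1`. -/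
theorem IsTransient.exists_weight {S : Type*} [Fintype S] [DecidableEq S] {Q : Matrix S S ℝ}
    (hQ : IsTransient Q) (h0 : ∀ s t, 0 ≤ Q s t) :
    ∃ v : S → ℝ, (∀ s, 0 < v s) ∧ ∀ s, ∑ t, Q s t * v t < v s := by
  have hlim : ∀ s, Tendsto (fun n : ℕ => ∑ t, (Q ^ n) s t) atTop (𝓝 0) := fun s => by
    simpa using tendsto_finsetSum Finset.univ (fun t _ => hQ s t)
  have hev : ∀ᶠ n : ℕ in atTop, ∀ s, ∑ t, (Q ^ n) s t < 1 :=
    eventually_all.2 fun s => (hlim s).eventually_lt_const one_pos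
  obtain ⟨n, hn, hn1⟩ := (hev.and (eventually_ge_atTop 1)).exists
  have hpow : ∀ (m : ℕ) s t, 0 ≤ (Q ^ m) s t := by
    intro m
    induction m with
    | zero =>
      intro s t
      rw [pow_zero, Matrix.one_apply]
      split_ifs <;> norm_num
    | succ m ih =>
      intro s t
      rw [pow_succ, Matrix.mul_apply]
      exact Finset.sum_nonneg fun u _ => mul_nonneg (ih s u) (h0 u t)
  refine ⟨fun s => ∑ m ∈ Finset.range n, ∑ t, (Q ^ m) s t, fun s => ?_, fun s => ?_⟩
  · refine lt_of_lt_of_le one_pos ?_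
    have h := Finset.single_le_sum (f := fun m => ∑ t, (Q ^ m) s t)
      (fun m _ => Finset.sum_nonneg fun t _ => hpow m s t) (Finset.mem_range.2 hn1)
    simpa [Matrix.one_apply] using h
  · have h : ∑ t, Q s t * ∑ m ∈ Finset.range n, ∑ u, (Q ^ m) t u
        = ∑ m ∈ Finset.range n, ∑ u, (Q ^ (m + 1)) s u := by
      simp_rw [Finset.mul_sum, pow_succ', Matrix.mul_apply]
      rw [Finset.sum_comm]
      refine Finset.sum_congr rfl fun m _ => ?_
      rw [Finset.sum_comm]
    have h1 := Finset.sum_range_succ (fun m => ∑ u, (Q ^ m) s u) n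
    rw [Finset.sum_range_succ' (fun m => ∑ u, (Q ^ m) s u) n] at h1
    have h2 : ∑ u, (Q ^ 0) s u = 1 := by simp [Matrix.one_apply]
    have h3 := hn s
    rw [h]
    linarith

/-- The maximum principle: if the nonnegative matrix `Q` strictly decreases a positive vector, then
a function that is dominated by its `Q`-average wherever it is positive is nowhere positive. -/
theorem nonpos_of_le_sum {S : Type*} [Fintype S] {Q : S → S → ℝ} {w g : S → ℝ}
    (hQ : ∀ s t, 0 ≤ Q s t) (hw : ∀ s, 0 < w s) (hQw : ∀ s, ∑ t, Q s t * w t < w s)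
    (hg : ∀ s, 0 < g s → g s ≤ ∑ t, Q s t * g t) (s : S) : g s ≤ 0 := by
  by_contra! hs
  obtain ⟨m, -, hm⟩ := Finset.exists_max_image Finset.univ (fun t => g t / w t)
    ⟨s, Finset.mem_univ s⟩
  have hc : 0 < g m / w m := (div_pos hs (hw s)).trans_le (hm s (Finset.mem_univ s))
  have hgm : 0 < g m := by
    have := mul_pos hc (hw m)
    rwa [div_mul_cancel₀ _ (hw m).ne'] at this
  have h1 : ∑ t, Q m t * g t ≤ (g m / w m) * ∑ t, Q m t * w t := by
    rw [Finset.mul_sum]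
    refine Finset.sum_le_sum fun t _ => ?_
    have := (div_le_iff₀ (hw t)).1 (hm t (Finset.mem_univ t))
    calc Q m t * g t ≤ Q m t * (g m / w m * w t) := mul_le_mul_of_nonneg_left this (hQ m t)
      _ = _ := by ring
  have h2 := mul_lt_mul_of_pos_left (hQw m) hc
  rw [div_mul_cancel₀ _ (hw m).ne'] at h2
  linarith [hg m hgm]

section Model

variable {ι : Type*} [Fintype ι] [DecidableEq ι] {N : ι → Type*}
  [∀ k, Fintype (N k)] [∀ k, DecidableEq (N k)]

/-- The part of the hypothesis that depends on the case at hand. -/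
def AttitudeBound (c : Attitude) (D : Data N) : Prop :=
  match c with
  | .neutral => ∀ k i, ∑ j, D.q k i j ≤ 1
  | .averse => ∀ k i, D.r k i ≤ 0
  | .seeking => ∀ k i, 0 ≤ D.r k i

/-- The form of the hypothesis that survives pivot steps: transience is witnessed by a family `v`
of positive vectors that the transition rate matrices strictly decrease.  A pivot step allows
the same `v` to be kept. -/
structure Admissible (c : Attitude) (v : ∀ k, N k → ℝ) (D : Data N) : Prop where
  pos : ∀ k i, 0 < v k i
  q_nonneg : ∀ k i j, 0 ≤ D.q k i j
  sum_lt : ∀ k i, ∑ j, D.q k i j * v k j < v k i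
  bound : AttitudeBound c D

theorem Hypothesis.exists_admissible {c : Attitude} {D : Data N} (h : Hypothesis c D) :
    ∃ v, Admissible c v D := by
  choose v hv hlt using fun k => (h.1 k).2.exists_weight (h.1 k).1
  refine ⟨v, hv, fun k => (h.1 k).1, hlt, ?_⟩
  have := h.2
  cases c <;> exact this

/-! ### Playing a bandit, and policy evaluation -/

/-- The expected utility of playing bandit `k` once in the multi-state `s`, if `F` is
the utility of the multi-state that is reached. -/
def play (D : Data N) (k : ι) (F : (∀ k, N k) → ℝ) (s : ∀ k, N k) : ℝ :=
  D.r k (s k) + ∑ j, D.q k (s k) j * F (Function.update s k j)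

theorem sum_policyMatrix_mul (D : Data N) (π : (∀ k, N k) → ι) (F : (∀ k, N k) → ℝ)
    (s : ∀ k, N k) :
    ∑ t, policyMatrix D π s t * F t
      = ∑ j, D.q (π s) (s (π s)) j * F (Function.update s (π s) j) := by
  symm
  refine Finset.sum_of_injOn (fun j => Function.update s (π s) j)
    (fun a _ b _ h => Function.update_injective s (π s) h) (fun _ _ => Finset.mem_univ _) ?_ ?_
  · intro t _ ht
    rw [policyMatrix, if_neg, zero_mul]
    intro h
    refine ht ⟨t (π s), by simp, ?_⟩
    funext k
    by_cases hk : k = π s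
    · subst hk; simp
    · simp [hk, h k hk]
  · intro j _
    rw [policyMatrix, if_pos]
    · simp
    · intro k hk
      simp [hk]

theorem policyMatrix_nonneg {D : Data N} (h : ∀ k i j, 0 ≤ D.q k i j) (π : (∀ k, N k) → ι)
    (s t : ∀ k, N k) : 0 ≤ policyMatrix D π s t := by
  rw [policyMatrix]
  split_ifs
  · exact h _ _ _
  · exact le_rfl

/-- The product of the weights of the bandits is strictly decreased by the matrix of every
policy. -/
theorem Admissible.sum_policyMatrix_lt {c : Attitude} {v : ∀ k, N k → ℝ} {D : Data N}
    (h : Admissible c v D) (π : (∀ k, N k) → ι) (s : ∀ k, N k) :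
    ∑ t, policyMatrix D π s t * ∏ k, v k (t k) < ∏ k, v k (s k) := by
  rw [sum_policyMatrix_mul]
  have hprod : ∀ t : ∀ k, N k, ∏ k, v k (t k)
      = v (π s) (t (π s)) * ∏ k ∈ Finset.univ.erase (π s), v k (t k) := fun t =>
    (Finset.mul_prod_erase _ _ (Finset.mem_univ _)).symm
  have hrest : ∀ j, ∏ k ∈ Finset.univ.erase (π s), v k (Function.update s (π s) j k)
      = ∏ k ∈ Finset.univ.erase (π s), v k (s k) := fun j =>
    Finset.prod_congr rfl fun k hk => by
      rw [Function.update_of_ne (Finset.ne_of_mem_erase hk)]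
  simp_rw [hprod, hrest, Function.update_self, ← mul_assoc]
  rw [← Finset.sum_mul]
  exact mul_lt_mul_of_pos_right (h.sum_lt _ _) (Finset.prod_pos fun k _ => h.pos _ _)

/-- The maximum principle for the matrix of a policy. -/
theorem Admissible.nonpos_of_le {c : Attitude} {v : ∀ k, N k → ℝ} {D : Data N}
    (h : Admissible c v D) (π : (∀ k, N k) → ι) {g : (∀ k, N k) → ℝ}
    (hg : ∀ s, 0 < g s →
      g s ≤ ∑ j, D.q (π s) (s (π s)) j * g (Function.update s (π s) j)) (s : ∀ k, N k) :
    g s ≤ 0 :=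
  nonpos_of_le_sum (policyMatrix_nonneg h.q_nonneg π)
    (fun _ => Finset.prod_pos fun _ _ => h.pos _ _) (h.sum_policyMatrix_lt π)
    (fun s hs => by rw [sum_policyMatrix_mul]; exact hg s hs) s

theorem Admissible.le_of_play {c : Attitude} {v : ∀ k, N k → ℝ} {D : Data N}
    (h : Admissible c v D) (π : (∀ k, N k) → ι) {F G : (∀ k, N k) → ℝ}
    (hF : ∀ s, F s ≤ play D (π s) F s) (hG : ∀ s, play D (π s) G s ≤ G s) (s : ∀ k, N k) :
    F s ≤ G s := by
  have := h.nonpos_of_le π (g := fun s => F s - G s) (fun s _ => by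
    simp_rw [mul_sub, Finset.sum_sub_distrib]
    have h1 := hF s
    have h2 := hG s
    simp only [play] at h1 h2
    linarith) s
  linarith

/-- The value of a policy is the fixed point of its one-step evaluation. -/
theorem Admissible.policyValue_eq_play {c : Attitude} {v : ∀ k, N k → ℝ} {D : Data N}
    (h : Admissible c v D) (π : (∀ k, N k) → ι) (s : ∀ k, N k) :
    policyValue D π s = play D (π s) (policyValue D π) s := by
  have hnp : ∀ x, (1 - policyMatrix D π).mulVec x = 0 → ∀ s, x s ≤ 0 := by
    intro x hx
    refine h.nonpos_of_le π fun s _ => ?_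
    have := congrFun hx s
    rw [Matrix.sub_mulVec, Matrix.one_mulVec] at this
    simp only [Pi.sub_apply, Pi.zero_apply, Matrix.mulVec, dotProduct] at this
    rw [sum_policyMatrix_mul] at this
    linarith
  have hunit : IsUnit (1 - policyMatrix D π) := by
    rw [← Matrix.mulVec_injective_iff_isUnit]
    refine (injective_iff_map_eq_zero (1 - policyMatrix D π).mulVecLin).2 fun x hx => ?_
    have hx' : (1 - policyMatrix D π).mulVec x = 0 := hx
    funext s
    refine le_antisymm (hnp x hx' s) ?_
    have := hnp (-x) (by rw [Matrix.mulVec_neg, hx', neg_zero]) s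
    simpa using this
  have hmul : (1 - policyMatrix D π).mulVec (policyValue D π) = policyReward D π := by
    rw [policyValue, Matrix.mulVec_mulVec,
      Matrix.mul_nonsing_inv _ ((Matrix.isUnit_iff_isUnit_det _).1 hunit), Matrix.one_mulVec]
  have := congrFun hmul s
  rw [Matrix.sub_mulVec, Matrix.one_mulVec] at this
  simp only [Pi.sub_apply, Matrix.mulVec, dotProduct] at this
  rw [sum_policyMatrix_mul, policyReward] at this
  rw [play]
  linarith

/-- The optimality equation has a solution.  It is the value of a policy whose total
value is largest: if playing some bandit were an improvement in some multi-state, switching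
to it there would increase the total value. -/
theorem Admissible.exists_optimality_equation [Nonempty ι] {c : Attitude} {v : ∀ k, N k → ℝ}
    {D : Data N} (h : Admissible c v D) :
    ∃ F : (∀ k, N k) → ℝ, (∀ s k, play D k F s ≤ F s) ∧ ∀ s, ∃ k, F s = play D k F s := by
  classical
  obtain ⟨π, hπ⟩ := Finite.exists_max (fun π : (∀ k, N k) → ι => ∑ s, policyValue D π s)
  refine ⟨policyValue D π, fun s k => ?_, fun s => ⟨π s, h.policyValue_eq_play π s⟩⟩
  by_contra! hlt
  let σ := Function.update π s k
  have hup : ∀ t, policyValue D π t ≤ play D (σ t) (policyValue D π) t := by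
    intro t
    by_cases ht : t = s
    · subst ht
      simpa [σ] using hlt.le
    · simpa [σ, ht] using (h.policyValue_eq_play π t).le
  have hle := h.le_of_play σ hup fun t => (h.policyValue_eq_play σ t).ge
  refine (hπ σ).not_gt (Finset.sum_lt_sum (fun t _ => hle t) ⟨s, Finset.mem_univ s, ?_⟩)
  have hs : play D k (policyValue D π) s ≤ play D k (policyValue D σ) s :=
    add_le_add_right (Finset.sum_le_sum fun j _ =>
      mul_le_mul_of_nonneg_left (hle _) (h.q_nonneg _ _ _)) _
  have := h.policyValue_eq_play σ s
  simp only [σ, Function.update_self] at this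
  linarith

/-- A policy that attains the maximum in the optimality equation everywhere is optimal. -/
theorem Admissible.policyValue_eq_optimalValue [Nonempty ι] {c : Attitude} {v : ∀ k, N k → ℝ}
    {D : Data N} (h : Admissible c v D) {F : (∀ k, N k) → ℝ} (hF : ∀ s k, play D k F s ≤ F s)
    {π : (∀ k, N k) → ι} (hπ : ∀ s, F s = play D (π s) F s) (s : ∀ k, N k) :
    policyValue D π s = optimalValue D s := by
  have hge : ∀ σ : (∀ k, N k) → ι, policyValue D σ s ≤ policyValue D π s := fun σ =>
    (h.le_of_play σ (fun t => (h.policyValue_eq_play σ t).le) (fun t => hF t (σ t)) s).trans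
      (h.le_of_play π (fun t => (hπ t).le) (fun t => (h.policyValue_eq_play π t).ge) s)
  exact le_antisymm (le_ciSup (f := fun σ => policyValue D σ s) (Set.finite_range _).bddAbove π)
    (ciSup_le hge)

/-! ### Weak preference is a total preorder -/

/-- The quantity by which the states of category 2 are ordered, the smaller the better:
`-r / (1 - a)` in the neutral case and `(1 - a) / r` in the other two.  Within the categories 1 and
3 all states are tied, so there the value is 0. -/
def preferenceIndex (c : Attitude) (D : Data N) (x : Σ k, N k) : ℝ :=
  if category c D x = 2 then
    match c with
    | .neutral => -(D.r x.1 x.2 / (1 - amplification D x))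
    | .averse => (1 - amplification D x) / D.r x.1 x.2
    | .seeking => (1 - amplification D x) / D.r x.1 x.2
  else 0

/-- The categories in terms of the points `(1 - a, r)`, which lie in a closed half-plane: the
states of category 2 are those in its interior. -/
theorem category_cases {c : Attitude} {D : Data N} (h : AttitudeBound c D) (x : Σ k, N k) :
    match (generalizing := false) c with
    | .neutral =>
        (category .neutral D x = 1 ∧ amplification D x = 1 ∧ 0 ≤ D.r x.1 x.2) ∨
        (category .neutral D x = 2 ∧ amplification D x < 1) ∨
        (category .neutral D x = 3 ∧ amplification D x = 1 ∧ D.r x.1 x.2 < 0)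
    | .averse =>
        (category .averse D x = 1 ∧ D.r x.1 x.2 = 0 ∧ amplification D x ≤ 1) ∨
        (category .averse D x = 2 ∧ D.r x.1 x.2 < 0) ∨
        (category .averse D x = 3 ∧ D.r x.1 x.2 = 0 ∧ 1 < amplification D x)
    | .seeking =>
        (category .seeking D x = 1 ∧ D.r x.1 x.2 = 0 ∧ 1 ≤ amplification D x) ∨
        (category .seeking D x = 2 ∧ 0 < D.r x.1 x.2) ∨
        (category .seeking D x = 3 ∧ D.r x.1 x.2 = 0 ∧ amplification D x < 1) := by
  cases c with
  | neutral =>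
    have hx : amplification D x ≤ 1 := h x.1 x.2
    dsimp only [category]
    split_ifs with h1 h2
    · simp [h1]
    · simp [h2]
    · have h3 := le_antisymm hx (not_lt.1 h2)
      simpa [h3] using h1
  | averse =>
    have hx : D.r x.1 x.2 ≤ 0 := h x.1 x.2
    dsimp only [category]
    split_ifs with h1 h2
    · simp [h1]
    · simp [h2]
    · have h3 := le_antisymm hx (not_lt.1 h2)
      simpa [h3] using h1
  | seeking =>
    have hx : 0 ≤ D.r x.1 x.2 := h x.1 x.2
    dsimp only [category]
    split_ifs with h1 h2
    · simp [h1]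
    · simp [h2]
    · have h3 := le_antisymm (not_lt.1 h2) hx
      simpa [h3] using h1

theorem le_of_category_lt {c : Attitude} {D : Data N} (h : AttitudeBound c D)
    {x y : Σ k, N k} (hlt : category c D x < category c D y) :
    D.r y.1 y.2 + amplification D y * D.r x.1 x.2
      ≤ D.r x.1 x.2 + amplification D x * D.r y.1 y.2 := by
  have hx := category_cases h x
  have hy := category_cases h y
  cases c <;> dsimp only at hx hy <;> rcases hx with ⟨h1, h2⟩ | ⟨h1, h2⟩ | ⟨h1, h2⟩ <;>
    rcases hy with ⟨h3, h4⟩ | ⟨h3, h4⟩ | ⟨h3, h4⟩ <;>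
    first
    | (rw [h1, h3] at hlt; omega)
    | (rw [h2.1]; nlinarith [h2.2])
    | (rw [h4.1]; nlinarith [h4.2])

theorem preferenceIndex_le_iff {c : Attitude} {D : Data N} (h : AttitudeBound c D)
    {x y : Σ k, N k} (heq : category c D x = category c D y) :
    preferenceIndex c D x ≤ preferenceIndex c D y ↔
      D.r y.1 y.2 + amplification D y * D.r x.1 x.2
        ≤ D.r x.1 x.2 + amplification D x * D.r y.1 y.2 := by
  have hx := category_cases h x
  have hy := category_cases h y
  unfold preferenceIndex
  rw [← heq]
  by_cases h2 : category c D x = 2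
  · rw [if_pos h2, if_pos h2]
    cases c <;> dsimp only at hx hy ⊢ <;> rw [← heq, h2] at hy <;> rw [h2] at hx <;>
      norm_num at hx hy
    · rw [neg_le_neg_iff, div_le_div_iff₀ (by linarith) (by linarith)]
      constructor <;> intro _ <;> linarith
    · rw [← neg_div_neg_eq (1 - amplification D x), ← neg_div_neg_eq (1 - amplification D y),
        div_le_div_iff₀ (by linarith) (by linarith)]
      constructor <;> intro _ <;> linarith
    · rw [div_le_div_iff₀ hx hy]
      constructor <;> intro _ <;> linarith
  · rw [if_neg h2, if_neg h2]
    simp only [le_refl, true_iff]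
    cases c <;> dsimp only at hx hy <;> rcases hx with ⟨h1, h3, _⟩ | ⟨h1, _⟩ | ⟨h1, h3, _⟩ <;>
      rcases hy with ⟨_, h4, _⟩ | ⟨h5, _⟩ | ⟨_, h4, _⟩ <;>
      first
      | exact absurd h1 h2
      | exact absurd (heq.trans h5) h2
      | (rw [h3, h4]; linarith)

/-- Weak preference compares first the category and then the index.  Geometrically, the points
`(1 - a, r)` lie in a closed half-plane, where they are ordered by angle, the category
telling the two boundary rays apart. -/
theorem weaklyPreferable_iff {c : Attitude} {D : Data N} (h : AttitudeBound c D)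
    (x y : Σ k, N k) :
    WeaklyPreferable c D x y ↔ toLex (category c D x, preferenceIndex c D x)
      ≤ toLex (category c D y, preferenceIndex c D y) := by
  rw [Prod.Lex.toLex_le_toLex, WeaklyPreferable]
  rcases lt_trichotomy (category c D x) (category c D y) with hlt | heq | hgt
  · have := le_of_category_lt h hlt
    simpa [hlt, hlt.le, eq_comm] using this.lt_or_eq
  · simp only [heq, le_refl, lt_irrefl, and_true, true_and, false_or,
      preferenceIndex_le_iff h heq]
    rw [le_iff_lt_or_eq, eq_comm]
  · have := le_of_category_lt h hgt
    simp [hgt.not_gt, hgt.not_ge, hgt.ne', this]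

theorem WeaklyPreferable.trans {c : Attitude} {D : Data N} (h : AttitudeBound c D)
    {x y z : Σ k, N k} (hxy : WeaklyPreferable c D x y) (hyz : WeaklyPreferable c D y z) :
    WeaklyPreferable c D x z := by
  rw [weaklyPreferable_iff h] at *
  exact hxy.trans hyz

theorem exists_weaklyPreferable {c : Attitude} {D : Data N} (h : AttitudeBound c D) {α : Type*}
    (f : α → Σ k, N k) {s : Set α} (hs : s.Finite) (hne : s.Nonempty) :
    ∃ x ∈ s, ∀ y ∈ s, WeaklyPreferable c D (f x) (f y) := by
  simp_rw [weaklyPreferable_iff h]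
  exact Set.exists_min_image s _ hs hne

/-- Preference depends only on the data of the two bandits involved. -/
theorem weaklyPreferable_congr {c : Attitude} {D D' : Data N} {x y : Σ k, N k}
    (hqx : D'.q x.1 = D.q x.1) (hrx : D'.r x.1 = D.r x.1)
    (hqy : D'.q y.1 = D.q y.1) (hry : D'.r y.1 = D.r y.1) :
    WeaklyPreferable c D' x y ↔ WeaklyPreferable c D x y := by
  have hc : ∀ {z : Σ k, N k}, D'.q z.1 = D.q z.1 → D'.r z.1 = D.r z.1 →
      category c D' z = category c D z := fun hq hr => by
    cases c <;> simp only [category, amplification, hq, hr] <;> congr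
  simp only [WeaklyPreferable, hc hqx hrx, hc hqy hry, amplification, hqx, hrx, hqy, hry]

theorem WeaklyPreferable.le {c : Attitude} {D : Data N} {x y : Σ k, N k}
    (h : WeaklyPreferable c D x y) :
    D.r y.1 y.2 + amplification D y * D.r x.1 x.2
      ≤ D.r x.1 x.2 + amplification D x * D.r y.1 y.2 :=
  h.elim le_of_lt fun h => h.1.ge

/-! ### The pivot step -/

/-- The multiple of the (unscaled) row `i` of the tableau that a pivot step for `i` adds to row
`j`.  This includes row `i` itself, since `1 / (1 - q i i) = 1 + q i i / (1 - q i i)`. -/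
def pivotCoeff (D : Data N) (k : ι) (M : Finset (N k)) (i j : N k) : ℝ :=
  if j ∈ M then D.q k j i / (1 - D.q k i i) else 0

theorem pivot_q_of_ne (D : Data N) {k l : ι} (M : Finset (N k)) (i : N k) (h : l ≠ k) :
    (pivot D k M i).q l = D.q l := by
  simp [pivot, h]

theorem pivot_r_of_ne (D : Data N) {k l : ι} (M : Finset (N k)) (i : N k) (h : l ≠ k) :
    (pivot D k M i).r l = D.r l := by
  simp [pivot, h]

theorem pivot_q_self (D : Data N) (k : ι) {M : Finset (N k)} {i : N k} (hi : i ∈ M)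
    (h : D.q k i i < 1) (j p : N k) :
    (pivot D k M i).q k j p
      = D.q k j p + pivotCoeff D k M i j * (D.q k i p - if p = i then 1 else 0) := by
  have h1 : 1 - D.q k i i ≠ 0 := by linarith
  have e : (1 : Matrix (N k) (N k) ℝ) i p = if p = i then 1 else 0 := by
    simp [Matrix.one_apply, eq_comm]
  simp only [pivot, Function.update_self, Matrix.sub_apply, pivotMatrix, pivotRow, pivotCoeff]
  by_cases hj : j = i
  · subst hj
    simp only [hi, if_true, e]
    field_simp
    ring
  · by_cases hM : j ∈ M
    · simp only [hj, hM, if_true, if_false, e]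
      field_simp
      ring
    · simp [hj, hM]

theorem pivot_r_self (D : Data N) (k : ι) {M : Finset (N k)} {i : N k} (hi : i ∈ M)
    (h : D.q k i i < 1) (j : N k) :
    (pivot D k M i).r k j = D.r k j + pivotCoeff D k M i j * D.r k i := by
  have h1 : 1 - D.q k i i ≠ 0 := by linarith
  simp only [pivot, Function.update_self, pivotVector, pivotReward, pivotCoeff]
  by_cases hj : j = i
  · subst hj
    simp only [hi, if_true]
    field_simp
    ring
  · by_cases hM : j ∈ M
    · simp only [hj, hM, if_true, if_false]
      field_simp
    · simp [hj, hM]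

theorem sum_pivot_q_self_mul (D : Data N) (k : ι) {M : Finset (N k)} {i : N k} (hi : i ∈ M)
    (h : D.q k i i < 1) (j : N k) (f : N k → ℝ) :
    ∑ p, (pivot D k M i).q k j p * f p
      = ∑ p, D.q k j p * f p + pivotCoeff D k M i j * (∑ p, D.q k i p * f p - f i) := by
  simp_rw [pivot_q_self D k hi h, add_mul, Finset.sum_add_distrib, mul_assoc, ← Finset.mul_sum,
    sub_mul, Finset.sum_sub_distrib]
  simp

theorem Admissible.q_self_lt_one {c : Attitude} {v : ∀ k, N k → ℝ} {D : Data N}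
    (h : Admissible c v D) (k : ι) (i : N k) : D.q k i i < 1 := by
  have h1 := Finset.single_le_sum (f := fun j => D.q k i j * v k j)
    (fun j _ => mul_nonneg (h.q_nonneg k i j) (h.pos k j).le) (Finset.mem_univ i)
  have h2 := h1.trans_lt (h.sum_lt k i)
  exact (mul_lt_iff_lt_one_left (h.pos k i)).1 h2

theorem Admissible.pivotCoeff_nonneg {c : Attitude} {v : ∀ k, N k → ℝ} {D : Data N}
    (h : Admissible c v D) (k : ι) (M : Finset (N k)) (i j : N k) :
    0 ≤ pivotCoeff D k M i j := by
  rw [pivotCoeff]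
  split_ifs
  · exact div_nonneg (h.q_nonneg k j i) (sub_nonneg.2 (h.q_self_lt_one k i).le)
  · exact le_rfl

/-- After the pivot step for `i`, no remaining state moves to `i`. -/
theorem Admissible.pivot_q_apply_pivot {c : Attitude} {v : ∀ k, N k → ℝ} {D : Data N}
    (h : Admissible c v D) (k : ι) {M : Finset (N k)} {i j : N k} (hi : i ∈ M) (hj : j ∈ M) :
    (pivot D k M i).q k j i = 0 := by
  have h1 : 1 - D.q k i i ≠ 0 := by linarith [h.q_self_lt_one k i]
  rw [pivot_q_self D k hi (h.q_self_lt_one k i), pivotCoeff, if_pos hj, if_pos rfl]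
  field_simp
  ring

/-- The hypothesis is preserved by pivot steps, with the same weights. -/
theorem Admissible.pivot {c : Attitude} {v : ∀ k, N k → ℝ} {D : Data N}
    (h : Admissible c v D) (k : ι) {M : Finset (N k)} {i : N k} (hi : i ∈ M) :
    Admissible c v (pivot D k M i) := by
  have h1 := h.q_self_lt_one k i
  have hc := h.pivotCoeff_nonneg k M i
  refine ⟨h.pos, fun l j p => ?_, fun l j => ?_, ?_⟩
  · by_cases hl : l = k
    · subst hl
      by_cases hp : p = i
      · subst hp
        by_cases hj : j ∈ M
        · exact (h.pivot_q_apply_pivot l hi hj).ge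
        · rw [pivot_q_self D l hi h1, pivotCoeff, if_neg hj, zero_mul, add_zero]
          exact h.q_nonneg _ _ _
      · rw [pivot_q_self D l hi h1, if_neg hp, sub_zero]
        exact add_nonneg (h.q_nonneg _ _ _) (mul_nonneg (hc j) (h.q_nonneg _ _ _))
    · rw [pivot_q_of_ne D M i hl]
      exact h.q_nonneg _ _ _
  · by_cases hl : l = k
    · subst hl
      rw [sum_pivot_q_self_mul D l hi h1]
      have := mul_nonpos_of_nonneg_of_nonpos (hc j) (sub_neg.2 (h.sum_lt l i)).le
      linarith [h.sum_lt l j]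
    · rw [pivot_q_of_ne D M i hl]
      exact h.sum_lt l j
  · have hb := h.bound
    cases c with
    | neutral =>
      intro l j
      by_cases hl : l = k
      · subst hl
        have e := sum_pivot_q_self_mul D l hi h1 j fun _ => 1
        simp only [mul_one] at e
        rw [e]
        have := mul_nonpos_of_nonneg_of_nonpos (hc j) (sub_nonpos.2 (hb l i))
        linarith [hb l j]
      · rw [pivot_q_of_ne D M i hl]
        exact hb l j
    | averse =>
      intro l j
      by_cases hl : l = k
      · subst hl
        rw [pivot_r_self D l hi h1]
        exact add_nonpos (hb l j) (mul_nonpos_of_nonneg_of_nonpos (hc j) (hb l i))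
      · rw [pivot_r_of_ne D M i hl]
        exact hb l j
    | seeking =>
      intro l j
      by_cases hl : l = k
      · subst hl
        rw [pivot_r_self D l hi h1]
        exact add_nonneg (hb l j) (mul_nonneg (hc j) (hb l i))
      · rw [pivot_r_of_ne D M i hl]
        exact hb l j

/-- If playing `k` in state `i` is fair under `F`, then a pivot step for `i` does not
change the expected utility of playing any bandit. -/
theorem Admissible.play_pivot {c : Attitude} {v : ∀ k, N k → ℝ} {D : Data N}
    (h : Admissible c v D) (k : ι) {M : Finset (N k)} {i : N k} (hi : i ∈ M)
    {F : (∀ k, N k) → ℝ} {s : ∀ k, N k}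
    (hF : F (Function.update s k i) = play D k F (Function.update s k i)) (l : ι) :
    play (Bandit.pivot D k M i) l F s = play D l F s := by
  by_cases hl : l = k
  · subst hl
    have h1 := h.q_self_lt_one l i
    simp only [play, Function.update_self, Function.update_idem] at hF ⊢
    rw [sum_pivot_q_self_mul D l hi h1 _ fun j => F (Function.update s l j),
      pivot_r_self D l hi h1, hF]
    ring
  · rw [play, play, pivot_q_of_ne D M i hl, pivot_r_of_ne D M i hl]

/-! ### Interchange -/

/-- Playing `k` and then `l` differs from playing `l` and then `k` only in the rewards. -/
theorem play_play_sub (D : Data N) {k l : ι} (h : l ≠ k) (F : (∀ k, N k) → ℝ) (s : ∀ k, N k) :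
    play D k (play D l F) s - play D l (play D k F) s
      = (D.r k (s k) + amplification D ⟨k, s k⟩ * D.r l (s l))
        - (D.r l (s l) + amplification D ⟨l, s l⟩ * D.r k (s k)) := by
  simp only [play, amplification, Function.update_of_ne h, Function.update_of_ne h.symm, mul_add,
    Finset.sum_add_distrib, Finset.sum_mul, Finset.mul_sum]
  have e : ∑ x, ∑ y, D.q k (s k) x *
        (D.q l (s l) y * F (Function.update (Function.update s k x) l y))
      = ∑ x, ∑ y, D.q l (s l) x *
        (D.q k (s k) y * F (Function.update (Function.update s l x) k y)) := by
    rw [Finset.sum_comm]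
    refine Finset.sum_congr rfl fun x _ => Finset.sum_congr rfl fun y _ => ?_
    rw [Function.update_comm h]
    ring
  rw [e]
  ring

/-- Let `M` be sets of states that the transition rates do not leave, and let `F` satisfy the
optimality equation on the multi-states in `M`.  If the state `i ∈ M k` is weakly preferable to all
states in `M`, then playing `k` is optimal in every multi-state in which bandit `k` is
in state `i`. -/
theorem Admissible.eq_play_of_weaklyPreferable {c : Attitude} {v : ∀ k, N k → ℝ} {D : Data N}
    (h : Admissible c v D) {M : ∀ k, Finset (N k)}
    (hM : ∀ k, ∀ i ∈ M k, ∀ j ∉ M k, D.q k i j = 0) {F : (∀ k, N k) → ℝ}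
    (hle : ∀ s, (∀ k, s k ∈ M k) → ∀ k, play D k F s ≤ F s)
    (heq : ∀ s, (∀ k, s k ∈ M k) → ∃ k, F s = play D k F s) {k : ι} {i : N k}
    (hi : ∀ l, ∀ j ∈ M l, WeaklyPreferable c D ⟨k, i⟩ ⟨l, j⟩)
    {s : ∀ k, N k} (hs : ∀ k, s k ∈ M k) (hsk : s k = i) : F s = play D k F s := by
  classical
  have : Nonempty ι := ⟨k⟩
  have hex : ∀ s : ∀ k, N k, ∃ l, (∀ k, s k ∈ M k) → F s = play D l F s := fun s => by
    by_cases hs : ∀ k, s k ∈ M k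
    · obtain ⟨l, hl⟩ := heq s hs
      exact ⟨l, fun _ => hl⟩
    · exact ⟨k, fun h => absurd h hs⟩
  choose σ hσ using hex
  have hupd : ∀ s : ∀ k, N k, (∀ k, s k ∈ M k) → ∀ l, ∀ j ∈ M l,
      ∀ k, Function.update s l j k ∈ M k := by
    intro s hs l j hj m
    by_cases hm : m = l
    · subst hm; simpa using hj
    · simpa [hm] using hs m
  -- The loss from playing `k` in the multi-states at hand is dominated by its average under an
  -- optimal policy, which leaves the state of bandit `k` alone as long as the loss is positive.
  have key := h.nonpos_of_le σ
    (g := fun s => if (∀ k, s k ∈ M k) ∧ s k = i then F s - play D k F s else 0) ?_ s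
  · rw [if_pos ⟨hs, hsk⟩] at key
    exact le_antisymm (by linarith) (hle s hs k)
  intro s hpos
  by_cases hsM : (∀ k, s k ∈ M k) ∧ s k = i
  swap
  · rw [if_neg hsM] at hpos
    exact absurd hpos (lt_irrefl 0)
  rw [if_pos hsM] at hpos ⊢
  obtain ⟨hs, hsk⟩ := hsM
  have hl := hσ s hs
  generalize σ s = l at hl ⊢
  have hlk : l ≠ k := by
    rintro rfl
    linarith
  have e : ∑ j, D.q l (s l) j * (if (∀ m, Function.update s l j m ∈ M m) ∧
        Function.update s l j k = i then
        F (Function.update s l j) - play D k F (Function.update s l j) else 0)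
      = play D l F s - play D l (play D k F) s := by
    rw [play, play, add_sub_add_left_eq_sub, ← Finset.sum_sub_distrib]
    refine Finset.sum_congr rfl fun j _ => ?_
    by_cases hj : j ∈ M l
    · rw [if_pos ⟨hupd s hs l j hj, by rw [Function.update_of_ne hlk.symm, hsk]⟩, mul_sub]
    · simp [hM l (s l) (hs l) j hj]
  have hswap := play_play_sub D hlk F s
  have hpref := (hi l (s l) (hs l)).le
  have hmono : play D k (play D l F) s ≤ play D k F s := by
    refine add_le_add_right (Finset.sum_le_sum fun j _ => ?_) _
    by_cases hj : j ∈ M k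
    · exact mul_le_mul_of_nonneg_left (hle _ (hupd s hs k j hj) l) (h.q_nonneg _ _ _)
    · simp [hM k (s k) (hs k) j hj]
  rw [e, ← hl]
  subst hsk
  dsimp only at hpref
  linarith

/-! ### The run of the Optimizer -/

/-- What holds throughout the execution of the Optimizer on the data `D`, where `F` is the solution
of the optimality equation of `D`.  The last two fields carry the optimality proof: on the
multi-states without labeled states, playing a bandit is worth the same under the current
as under the original data, and playing the bandit with the lowest label is optimal in
every multi-state that contains a labeled state. -/
structure RunInvariant (c : Attitude) (v : ∀ k, N k → ℝ) (D : Data N) (F : (∀ k, N k) → ℝ)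
    (m : Memory N) : Prop where
  admissible : Admissible c v m.data
  label_eq_none_iff : ∀ k i, m.label ⟨k, i⟩ = none ↔ i ∈ m.M k
  q_eq_zero : ∀ k, ∀ i ∈ m.M k, ∀ j ∉ m.M k, m.data.q k i j = 0
  candidate : ∀ x ∈ m.C, x.2 ∈ m.M x.1 ∧ ∀ j ∈ m.M x.1, WeaklyPreferable c m.data x ⟨x.1, j⟩
  exists_candidate : ∀ k, (m.M k).Nonempty → ∃ e, ⟨k, e⟩ ∈ m.C
  candidate_unique : ∀ x ∈ m.C, ∀ y ∈ m.C, x.1 = y.1 → x = y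
  label_bounds : ∀ x l, m.label x = some l → 1 ≤ l ∧ l < m.n
  label_injective : ∀ x y l, m.label x = some l → m.label y = some l → x = y
  card_unlabeled : m.n + ∑ k, (m.M k).card = Fintype.card (Σ k, N k) + 1
  play_eq : ∀ s, (∀ k, s k ∈ m.M k) → ∀ k, play m.data k F s = play D k F s
  optimal : ∀ x l, m.label x = some l → ∀ s : ∀ k, N k, s x.1 = x.2 →
    (∀ k l', m.label ⟨k, s k⟩ = some l' → l ≤ l') → F s = play D x.1 F s

theorem exists_isInitial [∀ k, Nonempty (N k)] {c : Attitude} {D : Data N}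
    (h : AttitudeBound c D) : ∃ m, IsInitial c D m := by
  have hex : ∀ k, ∃ e : N k, ∀ j, WeaklyPreferable c D ⟨k, e⟩ ⟨k, j⟩ := fun k => by
    obtain ⟨e, -, he⟩ := exists_weaklyPreferable h (fun j : N k => (⟨k, j⟩ : Σ k, N k))
      (Set.toFinite Set.univ) Set.univ_nonempty
    exact ⟨e, fun j => he j (Set.mem_univ j)⟩
  choose e he using hex
  exact ⟨⟨D, Set.range fun k => ⟨k, e k⟩, 1, fun _ => Finset.univ, fun _ => none⟩,
    rfl, ⟨e, he, rfl⟩, rfl, fun _ => rfl, fun _ => rfl⟩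

theorem IsInitial.runInvariant {c : Attitude} {v : ∀ k, N k → ℝ} {D : Data N}
    (hD : Admissible c v D) {m : Memory N} (hm : IsInitial c D m) (F : (∀ k, N k) → ℝ) :
    RunInvariant c v D F m := by
  obtain ⟨hdata, ⟨e, he, hC⟩, hn, hM, hlabel⟩ := hm
  refine ⟨hdata ▸ hD, by simp [hlabel, hM], by simp [hM], ?_, fun k _ => ⟨e k, by simp [hC]⟩, ?_,
    by simp [hlabel], by simp [hlabel], ?_, fun s _ k => by rw [hdata], by simp [hlabel]⟩
  · rw [hC, hdata]
    rintro _ ⟨k, rfl⟩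
    exact ⟨by simp [hM], fun j _ => he k j⟩
  · rw [hC]
    rintro _ ⟨k, rfl⟩ _ ⟨l, rfl⟩ h
    obtain rfl : k = l := h
    rfl
  · simp [hn, hM, add_comm]

theorem RunInvariant.weaklyPreferable {c : Attitude} {v : ∀ k, N k → ℝ} {D : Data N}
    {F : (∀ k, N k) → ℝ} {m : Memory N} (h : RunInvariant c v D F m) {x : Σ k, N k}
    (hx : ∀ y ∈ m.C, WeaklyPreferable c m.data x y) (l : ι) {j : N l} (hj : j ∈ m.M l) :
    WeaklyPreferable c m.data x ⟨l, j⟩ := by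
  obtain ⟨e, he⟩ := h.exists_candidate l ⟨j, hj⟩
  exact (hx _ he).trans h.admissible.bound ((h.candidate _ he).2 j hj)

theorem RunInvariant.exists_step [Nonempty ι] {c : Attitude} {v : ∀ k, N k → ℝ} {D : Data N}
    {F : (∀ k, N k) → ℝ} {m : Memory N} (h : RunInvariant c v D F m) (hm : ¬ Stopped m) :
    ∃ x m', Step c x m m' := by
  have hne : m.C.Nonempty := by
    obtain ⟨k⟩ := ‹Nonempty ι›
    obtain ⟨e, he⟩ := h.exists_candidate k
      (Finset.nonempty_iff_ne_empty.2 fun hk => hm ⟨k, hk⟩)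
    exact ⟨_, he⟩
  obtain ⟨x, hxC, hx⟩ := exists_weaklyPreferable h.admissible.bound id (Set.toFinite m.C) hne
  let M' := Function.update m.M x.1 ((m.M x.1).erase x.2)
  let D' := pivot m.data x.1 (m.M x.1) x.2
  rcases (M' x.1).eq_empty_or_nonempty with hM | hM
  · exact ⟨x, ⟨D', m.C \ {x}, m.n + 1, M', Function.update m.label x (some m.n)⟩,
      hm, hxC, hx, rfl, rfl, rfl, rfl, Or.inl ⟨hM, rfl⟩⟩
  · obtain ⟨j, hj, hpref⟩ := exists_weaklyPreferable
      (h.admissible.pivot x.1 (h.candidate x hxC).1).bound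
      (fun j : N x.1 => (⟨x.1, j⟩ : Σ k, N k)) (M' x.1).finite_toSet hM
    exact ⟨x, ⟨D', insert ⟨x.1, j⟩ (m.C \ {x}), m.n + 1, M',
        Function.update m.label x (some m.n)⟩,
      hm, hxC, hx, rfl, rfl, rfl, rfl, Or.inr ⟨j, hj, hpref, rfl⟩⟩

theorem RunInvariant.one_le_n {c : Attitude} {v : ∀ k, N k → ℝ} {D : Data N}
    {F : (∀ k, N k) → ℝ} {m : Memory N} (h : RunInvariant c v D F m) : 1 ≤ m.n := by
  have hcard := h.card_unlabeled
  have hle : ∑ k, (m.M k).card ≤ ∑ k, Fintype.card (N k) :=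
    Finset.sum_le_sum fun k _ => Finset.card_le_univ _
  rw [Fintype.card_sigma] at hcard
  omega

theorem RunInvariant.step {c : Attitude} {v : ∀ k, N k → ℝ} {D : Data N}
    {F : (∀ k, N k) → ℝ} (hle : ∀ s k, play D k F s ≤ F s) (heq : ∀ s, ∃ k, F s = play D k F s)
    {m m' : Memory N} (h : RunInvariant c v D F m) {x : Σ k, N k} (hstep : Step c x m m') :
    RunInvariant c v D F m' := by
  obtain ⟨-, hxC, hpref, hlabel, hn, hdata, hM, hC⟩ := hstep
  obtain ⟨k, i⟩ := x
  dsimp only at hdata hM hC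
  have hi : i ∈ m.M k := (h.candidate _ hxC).1
  have hnone : m.label ⟨k, i⟩ = none := (h.label_eq_none_iff k i).2 hi
  have hMk : m'.M k = (m.M k).erase i := by simp [hM]
  have hMl : ∀ l, l ≠ k → m'.M l = m.M l := fun l hl => by simp [hM, hl]
  have hMsub : ∀ l j, j ∈ m'.M l → j ∈ m.M l := fun l j hj => by
    by_cases hl : l = k
    · subst hl
      rw [hMk] at hj
      exact Finset.mem_of_mem_erase hj
    · rwa [hMl l hl] at hj
  have hdq : ∀ l, l ≠ k → m'.data.q l = m.data.q l := fun l hl => by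
    rw [hdata, pivot_q_of_ne _ _ _ hl]
  have hdr : ∀ l, l ≠ k → m'.data.r l = m.data.r l := fun l hl => by
    rw [hdata, pivot_r_of_ne _ _ _ hl]
  have hlx : m'.label ⟨k, i⟩ = some m.n := by simp [hlabel]
  have hly : ∀ y, y ≠ ⟨k, i⟩ → m'.label y = m.label y := fun y hy => by simp [hlabel, hy]
  -- The other candidates belong to other bandits, whose data and states are left alone.
  have hCne : ∀ y ∈ m.C \ {⟨k, i⟩}, y.1 ≠ k := fun y hy hyk =>
    hy.2 (h.candidate_unique y hy.1 _ hxC hyk)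
  have hCold : ∀ y ∈ m.C \ {⟨k, i⟩},
      y.2 ∈ m'.M y.1 ∧ ∀ j ∈ m'.M y.1, WeaklyPreferable c m'.data y ⟨y.1, j⟩ := fun y hy => by
    have hyk := hCne y hy
    rw [hMl _ hyk]
    refine ⟨(h.candidate y hy.1).1, fun j hj => ?_⟩
    exact (weaklyPreferable_congr (y := ⟨y.1, j⟩) (hdq _ hyk) (hdr _ hyk) (hdq _ hyk)
      (hdr _ hyk)).2 ((h.candidate y hy.1).2 j hj)
  have hsub : m.C \ {⟨k, i⟩} ⊆ m'.C := by
    rcases hC with ⟨-, hC⟩ | ⟨j, -, -, hC⟩ <;> rw [hC]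
    exact Set.subset_insert _ _
  have hfair : ∀ s : ∀ k, N k, (∀ l, s l ∈ m.M l) → s k = i → F s = play m.data k F s :=
    fun s hs hsk => h.admissible.eq_play_of_weaklyPreferable h.q_eq_zero
      (fun s hs l => (h.play_eq s hs l).le.trans (hle s l))
      (fun s hs => (heq s).imp fun l hl => hl.trans (h.play_eq s hs l).symm)
      (fun l j hj => h.weaklyPreferable hpref l hj) hs hsk
  refine ⟨?_, ?_, ?_, ?_, ?_, ?_, ?_, ?_, ?_, ?_, ?_⟩
  · rw [hdata]
    exact h.admissible.pivot k hi
  · intro l j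
    by_cases hx : (⟨l, j⟩ : Σ k, N k) = ⟨k, i⟩
    · cases hx
      simp [hlx, hMk]
    · rw [hly _ hx, h.label_eq_none_iff]
      by_cases hl : l = k
      · subst hl
        have : j ≠ i := fun hj => hx (by rw [hj])
        simp [hMk, this]
      · rw [hMl l hl]
  · intro l j hj p hp
    by_cases hl : l = k
    · subst hl
      have hj' := hMsub _ _ hj
      rw [hdata]
      by_cases hpi : p = i
      · subst hpi
        exact h.admissible.pivot_q_apply_pivot l hi hj'
      · have hp' : p ∉ m.M l := fun hpM => hp (by rw [hMk]; exact Finset.mem_erase.2 ⟨hpi, hpM⟩)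
        rw [pivot_q_self _ l hi (h.admissible.q_self_lt_one l i), if_neg hpi,
          h.q_eq_zero l j hj' p hp', h.q_eq_zero l i hi p hp']
        ring
    · rw [hMl l hl] at hj hp
      rw [hdq l hl]
      exact h.q_eq_zero l j hj p hp
  · rcases hC with ⟨-, hC⟩ | ⟨j, hj, hjpref, hC⟩ <;> rw [hC]
    · exact hCold
    · rintro y (rfl | hy)
      · exact ⟨hj, hjpref⟩
      · exact hCold y hy
  · intro l hl
    by_cases hlk : l = k
    · subst hlk
      rcases hC with ⟨hemp, -⟩ | ⟨j, -, -, hC⟩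
      · rw [hemp] at hl
        exact absurd hl Finset.not_nonempty_empty
      · exact ⟨j, hC ▸ Set.mem_insert _ _⟩
    · rw [hMl l hlk] at hl
      obtain ⟨e, he⟩ := h.exists_candidate l hl
      exact ⟨e, hsub ⟨he, fun hx => hlk (congrArg Sigma.fst hx)⟩⟩
  · rcases hC with ⟨-, hC⟩ | ⟨j, -, -, hC⟩ <;> rw [hC]
    · exact fun y hy z hz => h.candidate_unique y hy.1 z hz.1
    · rintro y (rfl | hy) z (rfl | hz) hyz
      · rfl
      · exact absurd hyz.symm (hCne z hz)
      · exact absurd hyz (hCne y hy)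
      · exact h.candidate_unique y hy.1 z hz.1 hyz
  · intro y l hy
    rw [hn]
    by_cases hyx : y = ⟨k, i⟩
    · rw [hyx, hlx, Option.some_inj] at hy
      have := h.one_le_n
      omega
    · rw [hly y hyx] at hy
      have := h.label_bounds y l hy
      omega
  · intro y z l hy hz
    by_cases hyx : y = ⟨k, i⟩ <;> by_cases hzx : z = ⟨k, i⟩
    · rw [hyx, hzx]
    · rw [hyx, hlx, Option.some_inj] at hy
      rw [hly z hzx] at hz
      have := h.label_bounds z l hz
      omega
    · rw [hzx, hlx, Option.some_inj] at hz
      rw [hly y hyx] at hy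
      have := h.label_bounds y l hy
      omega
    · rw [hly y hyx] at hy
      rw [hly z hzx] at hz
      exact h.label_injective y z l hy hz
  · have h1 := h.card_unlabeled
    have h2 := Finset.add_sum_erase Finset.univ (fun l => (m.M l).card) (Finset.mem_univ k)
    have h3 := Finset.add_sum_erase Finset.univ (fun l => (m'.M l).card) (Finset.mem_univ k)
    have h4 : ∑ l ∈ Finset.univ.erase k, (m'.M l).card = ∑ l ∈ Finset.univ.erase k, (m.M l).card :=
      Finset.sum_congr rfl fun l hl => by rw [hMl l (Finset.ne_of_mem_erase hl)]
    have h5 := Finset.card_erase_add_one hi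
    rw [hMk] at h3
    omega
  · intro s hs l
    have hs' : ∀ l, s l ∈ m.M l := fun l => hMsub _ _ (hs l)
    rw [← h.play_eq s hs' l, hdata]
    refine h.admissible.play_pivot k hi (hfair _ (fun l => ?_) (Function.update_self _ _ _)) l
    by_cases hl : l = k
    · subst hl
      simpa using hi
    · simpa [hl] using hs' l
  · intro y l hy s hsy hmin
    by_cases hyx : y = ⟨k, i⟩
    · subst hyx
      dsimp only at hsy ⊢
      rw [hlx, Option.some_inj] at hy
      subst hy
      have hs : ∀ p, s p ∈ m.M p := fun p => by
        rw [← h.label_eq_none_iff]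
        by_cases hp : (⟨p, s p⟩ : Σ k, N k) = ⟨k, i⟩
        · rw [hp, hnone]
        · rw [Option.eq_none_iff_forall_ne_some]
          intro l' hl'
          have h1 := hmin p l' (by rw [hly _ hp, hl'])
          have h2 := (h.label_bounds _ l' hl').2
          omega
      rw [← h.play_eq s hs]
      exact hfair s hs hsy
    · rw [hly y hyx] at hy
      refine h.optimal y l hy s hsy fun p l' hl' => hmin p l' ?_
      rw [hly _ ?_, hl']
      intro hp
      rw [hp, hnone] at hl'
      cases hl'

theorem Reachable.runInvariant {c : Attitude} {v : ∀ k, N k → ℝ} {D : Data N}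
    (hD : Admissible c v D) {F : (∀ k, N k) → ℝ} (hle : ∀ s k, play D k F s ≤ F s)
    (heq : ∀ s, ∃ k, F s = play D k F s) {m : Memory N} (hm : Reachable c D m) :
    RunInvariant c v D F m := by
  obtain ⟨m₀, h₀, hrun⟩ := hm
  induction hrun with
  | refl => exact h₀.runInvariant hD F
  | tail _ hstep ih =>
    obtain ⟨x, hx⟩ := hstep
    exact ih.step hle heq hx

/-! ### Completing the labeling -/

theorem RunInvariant.exists_completes {c : Attitude} {v : ∀ k, N k → ℝ} {D : Data N}
    {F : (∀ k, N k) → ℝ} {m : Memory N} (h : RunInvariant c v D F m) : ∃ L, Completes m L := by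
  let U : Finset (Σ k, N k) := Finset.univ.sigma m.M
  have hU : ∀ x, m.label x = none ↔ x ∈ U := fun x => by
    simp [U, h.label_eq_none_iff x.1 x.2]
  have hcard : m.n + U.card = Fintype.card (Σ k, N k) + 1 := by
    rw [Finset.card_sigma]
    exact h.card_unlabeled
  refine ⟨fun x => if hx : x ∈ U then m.n + U.equivFin ⟨x, hx⟩ else (m.label x).getD 0, ?_, ?_, ?_⟩
  · intro x l hx
    have : x ∉ U := fun hxU => by simp [(hU x).2 hxU] at hx
    simp [this, hx]
  · intro x hx
    have hxU := (hU x).1 hx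
    have := (U.equivFin ⟨x, hxU⟩).2
    simp only [hxU, dif_pos]
    omega
  · intro x hx y hy hxy
    have hxU := (hU x).1 hx
    have hyU := (hU y).1 hy
    simp only [hxU, hyU, dif_pos, add_right_inj, Fin.val_inj] at hxy
    simpa using U.equivFin.injective hxy

theorem RunInvariant.isLabeling {c : Attitude} {v : ∀ k, N k → ℝ} {D : Data N}
    {F : (∀ k, N k) → ℝ} {m : Memory N} (h : RunInvariant c v D F m)
    {L : (Σ k, N k) → ℕ} (hL : Completes m L) : IsLabeling L := by
  obtain ⟨h1, h2, h3⟩ := hL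
  have hcard := h.card_unlabeled
  have hn := h.one_le_n
  refine ⟨fun x y hxy => ?_, fun x => ?_⟩
  · rcases hx : m.label x with _ | l <;> rcases hy : m.label y with _ | l'
    · exact h3 hx hy hxy
    · have := h2 x hx
      have := h1 y l' hy
      have := h.label_bounds y l' hy
      omega
    · have := h2 y hy
      have := h1 x l hx
      have := h.label_bounds x l hx
      omega
    · rw [h1 x l hx, h1 y l' hy] at hxy
      exact h.label_injective x y l hx (hxy ▸ hy)
  · rcases hx : m.label x with _ | l
    · have := h2 x hx
      omega
    · have := h1 x l hx
      have := h.label_bounds x l hx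
      omega

/-- When the Optimizer has stopped, every multi-state contains a labeled state, so the priority
rule plays a labeled state and the labels given afterwards do not matter. -/
theorem RunInvariant.eq_play_priorityRule [Nonempty ι] {c : Attitude} {v : ∀ k, N k → ℝ}
    {D : Data N} {F : (∀ k, N k) → ℝ} {m : Memory N} (h : RunInvariant c v D F m)
    (hm : Stopped m) {L : (Σ k, N k) → ℕ} (hL : Completes m L) (s : ∀ k, N k) :
    F s = play D (priorityRule L s) F s := by
  obtain ⟨h1, h2, -⟩ := hL
  have hmin : ∀ k, L ⟨priorityRule L s, s (priorityRule L s)⟩ ≤ L ⟨k, s k⟩ := fun k =>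
    Function.argmin_le (fun k => L ⟨k, s k⟩) k
  generalize priorityRule L s = p at hmin ⊢
  rcases hp : m.label ⟨p, s p⟩ with _ | l
  · exfalso
    obtain ⟨k, hk⟩ := hm
    rcases hsk : m.label ⟨k, s k⟩ with _ | l
    · rw [h.label_eq_none_iff, hk] at hsk
      exact absurd hsk (Finset.notMem_empty _)
    · have := hmin k
      have := h1 _ l hsk
      have := h.label_bounds _ l hsk
      have := h2 _ hp
      omega
  · refine h.optimal ⟨p, s p⟩ l hp s rfl fun k l' hl' => ?_
    rw [← h1 _ l hp, ← h1 _ l' hl']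
    exact hmin k

end Model

end Bandit

end

theorem proposition6p1 {ι : Type*} [Fintype ι] [DecidableEq ι] [Nonempty ι]
    {N : ι → Type*} [∀ k, Fintype (N k)] [∀ k, DecidableEq (N k)] [∀ k, Nonempty (N k)]
    (c : Bandit.Attitude) (D : Bandit.Data N) (hD : Bandit.Hypothesis c D) :
    -- The Optimizer can start, is never stuck before it stops, and always stops.
    (∃ m, Bandit.IsInitial c D m) ∧
    (∀ m, Bandit.Reachable c D m → ¬ Bandit.Stopped m → ∃ x m', Bandit.Step c x m m') ∧
    (¬ ∃ m : ℕ → Bandit.Memory N, Bandit.IsInitial c D (m 0) ∧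
      ∀ t, ∃ x, Bandit.Step c x (m t) (m (t + 1))) ∧
    -- Each state that it labels is weakly preferable to all unlabeled states.
    (∀ m m' x, Bandit.Reachable c D m → Bandit.Step c x m m' →
      ∀ y, m.label y = none → Bandit.WeaklyPreferable c m.data x y) ∧
    -- When it stops, the labels can be completed, and every completion is an optimal labeling.
    (∀ m, Bandit.Reachable c D m → Bandit.Stopped m →
      (∃ L, Bandit.Completes m L) ∧
      ∀ L, Bandit.Completes m L → Bandit.IsOptimalLabeling D L) := by
  obtain ⟨v, hv⟩ := hD.exists_admissible
  obtain ⟨F, hle, heq⟩ := hv.exists_optimality_equation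
  refine ⟨Bandit.exists_isInitial hv.bound,
    fun m hm hns => (hm.runInvariant hv hle heq).exists_step hns, ?_, ?_, fun m hm hend => ?_⟩
  · rintro ⟨m, h₀, hstep⟩
    have hinv : ∀ t, Bandit.RunInvariant c v D F (m t) ∧ t ≤ (m t).n := fun t => by
      induction t with
      | zero => exact ⟨h₀.runInvariant hv F, Nat.zero_le _⟩
      | succ t ih =>
        obtain ⟨x, hx⟩ := hstep t
        exact ⟨ih.1.step hle heq hx, hx.2.2.2.2.1 ▸ Nat.succ_le_succ ih.2⟩
    obtain ⟨h1, h2⟩ := hinv (Fintype.card (Σ k, N k) + 2)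
    have := h1.card_unlabeled
    omega
  · intro m m' x hm hx y hy
    have h := hm.runInvariant hv hle heq
    exact h.weaklyPreferable hx.2.2.1 y.1 ((h.label_eq_none_iff y.1 y.2).1 hy)
  · have h := hm.runInvariant hv hle heq
    exact ⟨h.exists_completes, fun L hL => ⟨h.isLabeling hL, fun s =>
      hv.policyValue_eq_optimalValue hle (h.eq_play_priorityRule hend hL) s⟩⟩
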